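/- Let $\mathcal D$ be a set. Let $\mathcal T$ be the set of plane rooted trees whose vertices are decorated by elements of $\mathcal D$, let $\mathcal F$ be the set of plane forests $F=t_1\cdots t_n$ (words in the elements of $\mathcal T$; the empty forest is $1$), and let $\mathcal H$ be the free associative $\mathbb Q$-algebra generated by $\mathcal T$, so that $\mathcal F$ is a $\mathbb Q$-basis of $\mathcal H$. An admissible cut $c$ of a tree $t$ is a set of edges of $t$ such that every ascending path meets at most one of them; $R^c(t)$ is the component of the root after the cut and $P^c(t)$ is the plane forest of the other components, in left-to-right order. In addition there is the total cut, with $P^c(t)=t$ and $R^c(t)=1$. A cut $c=(c_1,\dots,c_n)$ of a forest $t_1\cdots t_n$ is a choice of such a cut (possibly empty or total) of each $t_i$, with $P^c$ and $R^c$ the products of the $P^{c_i}(t_i)$ and of the $R^{c_i}(t_i)$. Let $\Delta:\mathcal H\to\mathcal H\otimes\mathcal H$ and $\varepsilon:\mathcal H\to\mathbb Q$ be the linear maps with $\Delta(F)=\sum_c P^c(F)\otimes R^c(F)$ and $\varepsilon(F)=\delta_{F,1}$ for $F\in\mathcal F$. For $d\in\mathcal D$ let $B_d^+:\mathcal H\to\mathcal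 H$ be the linear map that grafts the trees of a forest on a common new root decorated by $d$, and let $\gamma_d:\mathcal H\to\mathcal H$ be the linear map with $\gamma_d(1)=0$, $\gamma_d(t_1\cdots t_n)=t_1\cdots t_{n-1}$ if $t_n$ is the one-vertex tree decorated by $d$, and $\gamma_d(t_1\cdots t_n)=0$ otherwise. Let $\mathcal A$ be the subring of $\mathcal H$ generated by $\mathcal T$. Then $\varepsilon(\mathcal A)\subseteq\mathbb Z$, and $\Delta$ maps $\mathcal A$ into the subgroup of $\mathcal H\otimes\mathcal H$ generated by the elements $a\otimes b$ with $a,b\in\mathcal A$. There is a unique bilinear form $(\,,)$ on $\mathcal H$ such that for all $x,x_1,x_2,y\in\mathcal H$ and $d\in\mathcal D$ $$(1,x)=\varepsilon(x),\qquad (x_1x_2,y)=(x_1\otimes x_2,\Delta(y)),\qquad (B_d^+(x),y)=(x,\gamma_d(y)).$$ There is a unique family $(e_F)_{F\in\mathcal F}$ of elements of $\mathcal H$ such that $(e_F,G)=\delta_{F,G}$ for all $F,G\in\mathcal F$, and this family $(e_F)_{F\in\mathcal F}$ is a $\mathbb Z$-basis of $\mathcal A$. -/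

import Mathlib

open scoped TensorProduct

/-- Plane rooted trees decorated by `D`: a root with its decoration, and the ordered list of
the subtrees attached to the root. -/
inductive PTree (D : Type*) : Type _
  | node : D → List (PTree D) → PTree D

namespace PTree

variable {D : Type*}

/-- The tree with a single vertex decorated by `d`. -/
def dot (d : D) : PTree D := node d []

mutual
/-- All the ways of marking the vertices of a tree by a boolean.  The mark of a vertex `s` says
whether the edge arriving at `s` is cut.  No edge arrives at the root: marking the root
stands for the total cut, which has the whole tree as cut-off part and leaves the empty forest. -/
def cuts : PTree D → List (PTree (D × Bool))
  | node d ts => (cutsList ts).flatMap fun us => [node (d, false) us, node (d, true) us]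
/-- All the ways of marking the vertices of a forest. -/
def cutsList : List (PTree D) → List (List (PTree (D × Bool)))
  | [] => [[]]
  | t :: ts => (cuts t).flatMap fun u => (cutsList ts).map fun us => u :: us
end

mutual
/-- The largest number of marks on an ascending path of a marked tree. -/
def maxCuts : PTree (D × Bool) → ℕ
  | node x us => x.2.toNat + maxCutsList us
/-- The largest number of marks on an ascending path of a marked forest. -/
def maxCutsList : List (PTree (D × Bool)) → ℕ
  | [] => 0
  | u :: us => max (maxCuts u) (maxCutsList us)
end

mutual
/-- Forget the marks of a tree. -/
def unmark : PTree (D × Bool) → PTree D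
  | node x us => node x.1 (unmarkList us)
/-- Forget the marks of a forest. -/
def unmarkList : List (PTree (D × Bool)) → List (PTree D)
  | [] => []
  | u :: us => unmark u :: unmarkList us
end

mutual
/-- The plane forest cut off from a tree by an admissible cut, from left to right. -/
def pruned : PTree (D × Bool) → List (PTree D)
  | node x us => if x.2 then [node x.1 (unmarkList us)] else prunedList us
/-- The plane forest cut off from a forest by an admissible cut, from left to right. -/
def prunedList : List (PTree (D × Bool)) → List (PTree D)
  | [] => []
  | u :: us => pruned u ++ prunedList us
end

mutual
/-- What remains of a tree after an admissible cut: the component of the root, or the empty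
forest for the total cut. -/
def trunk : PTree (D × Bool) → List (PTree D)
  | node x us => if x.2 then [] else [node x.1 (trunkList us)]
/-- What remains of a forest after an admissible cut. -/
def trunkList : List (PTree (D × Bool)) → List (PTree D)
  | [] => []
  | u :: us => trunk u ++ trunkList us
end

/-- The admissible cuts of a forest (the empty and the total cut included): no ascending path
meets more than one cut.  Each one occurs exactly once in the list. -/
def admissibleCuts (F : List (PTree D)) : List (List (PTree (D × Bool))) :=
  (cutsList F).filter fun c => maxCutsList c ≤ 1

end PTree

/-- Plane rooted decorated forests: the monomials in the trees; `1` is the empty forest. -/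
abbrev PForest (D : Type*) := FreeMonoid (PTree D)

/-- The free associative algebra over `ℚ` generated by the trees. -/
abbrev HPR (D : Type*) := FreeAlgebra ℚ (PTree D)

noncomputable section

namespace HPR

variable {D : Type*}

/-- A forest, seen as a monomial of the free algebra. -/
def forest : PForest D →* HPR D := FreeMonoid.lift (FreeAlgebra.ι ℚ)

/-- The basis of the free algebra made of the forests. -/
def forestBasis (D : Type*) : Module.Basis (PForest D) ℚ (HPR D) :=
  FreeAlgebra.basisFreeMonoid ℚ (PTree D)

theorem forestBasis_apply (F : PForest D) : forestBasis D F = forest F := by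
  simp [forestBasis, FreeAlgebra.basisFreeMonoid, forest, FreeAlgebra.equivMonoidAlgebraFreeMonoid]

/-- The coproduct: `Δ(F) = ∑ P^c(F) ⊗ R^c(F)`, over all admissible cuts `c` of the forest `F`. -/
def coproduct : HPR D →ₗ[ℚ] HPR D ⊗[ℚ] HPR D :=
  (forestBasis D).constr ℚ fun F =>
    ((PTree.admissibleCuts F.toList).map fun c =>
      forest (FreeMonoid.ofList (PTree.prunedList c)) ⊗ₜ[ℚ]
        forest (FreeMonoid.ofList (PTree.trunkList c))).sum

open Classical in
/-- The counit: `1` on the empty forest, `0` on the other forests. -/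
def counit : HPR D →ₗ[ℚ] ℚ :=
  (forestBasis D).constr ℚ fun F => if F = 1 then 1 else 0

/-- The operator `B_d^+`: graft all the trees of a forest on a common root decorated by `d`. -/
def graft (d : D) : HPR D →ₗ[ℚ] HPR D :=
  (forestBasis D).constr ℚ fun F => FreeAlgebra.ι ℚ (PTree.node d F.toList)

open Classical in
/-- The operator `γ_d`: `t₁ ⋯ tₙ` is sent to `t₁ ⋯ tₙ₋₁` if `tₙ` is the one-vertex tree
decorated by `d`, and to `0` otherwise; `1` is sent to `0`. -/
def gamma (d : D) : HPR D →ₗ[ℚ] HPR D :=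
  (forestBasis D).constr ℚ fun F =>
    if F.toList.getLast? = some (PTree.dot d) then
      forest (FreeMonoid.ofList F.toList.dropLast) else 0

/-- The three properties that define the bilinear form `( , )`. -/
structure IsPairing (β : HPR D →ₗ[ℚ] HPR D →ₗ[ℚ] ℚ) : Prop where
  one_left : ∀ x, β 1 x = counit x
  /-- `(x₁ x₂, y) = (x₁ ⊗ x₂, Δ(y))` -/
  mul_left : ∀ x₁ x₂ y,
    β (x₁ * x₂) y = LinearMap.mul' ℚ ℚ (TensorProduct.map (β x₁) (β x₂) (coproduct y))
  graft_left : ∀ (d : D) x y, β (graft d x) y = β x (gamma d y)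

open Classical in
/-- `(e_F, G) = δ_{F,G}` for all forests `F` and `G`. -/
def IsDualFamily (β : HPR D →ₗ[ℚ] HPR D →ₗ[ℚ] ℚ) (e : PForest D → HPR D) : Prop :=
  ∀ F G : PForest D, β (e F) (forest G) = if F = G then 1 else 0

end HPR

/-- The subring of `HPR D` generated by the trees: the free algebra over `ℤ` on the trees. -/
def APR (D : Type*) : Subring (HPR D) :=
  Subring.closure (Set.range (FreeAlgebra.ι ℚ : PTree D → HPR D))

end

-- A plane forest is obtained from `1` by products and graftings, so the three rules compute all
-- pairings of forests by recursion: the form is unique, with integer values. For existence, the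
-- recursion is taken as the definition (`pair`), and coassociativity of the cuts (`cutSum_coassoc`)
-- gives the product rule for any factorization (`pair_append`). Sums over cuts are kept as `cutSum
-- φ F`, with φ arbitrary, so that iterated coproducts are nested sums.
--
-- The form respects the multiset of decorations, and each multiset is carried by finitely many
-- forests. The heart is `exists_dual`: every forest has a dual element with integer coefficients.
-- If `x` is dual to `G` and `y` to `F`, then `x * graft d y` is dual to `F B_d^+(G)` up to forests
-- whose last tree is strictly smaller (`mul_graft_apply`). This triangularity has ones on the
-- diagonal, so subtracting integral multiples of earlier dual elements suffices
-- (`exists_dual_of_lower`).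
--
-- Inverting the Gram matrix in each degree then gives `x = ∑ (x, F) e_F` (`exists_eq_sum`), hence
-- uniqueness of the dual family, and integral coordinates for `x` in `APR D`.

namespace PTree

-- Sums over admissible cuts and coassociativity

variable {D : Type*} {M : Type*} [AddCommMonoid M]

/-- Induction on plane forests, seen as binary trees: the subtrees of the root of the first tree,
and the remaining trees. -/
theorem forest_induction {P : List (PTree D) → Prop} (nil : P [])
    (cons : ∀ d ts r, P ts → P r → P (node d ts :: r)) : ∀ F, P F
  | [] => nil
  | node d ts :: r => cons d ts r (forest_induction nil cons ts) (forest_induction nil cons r)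

theorem sum_map_filter_eq {α : Type*} (l : List α) (p : α → Prop) [DecidablePred p] (f : α → M) :
    ((l.filter fun a => p a).map f).sum = (l.map fun a => if p a then f a else 0).sum := by
  induction l with
  | nil => simp
  | cons a l ih => by_cases h : p a <;> simp [h, ih]

theorem sum_map_flatMap {α β : Type*} (l : List α) (g : α → List β) (f : β → M) :
    ((l.flatMap g).map f).sum = (l.map fun a => ((g a).map f).sum).sum := by
  induction l with
  | nil => simp
  | cons a l ih => simp [ih]

theorem sum_map_comm {α β : Type*} (l : List α) (l' : List β) (f : α → β → M) :
    (l.map fun a => (l'.map (f a)).sum).sum = (l'.map fun b => (l.map fun a => f a b).sum).sum := by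
  induction l with
  | nil => simp
  | cons a l ih => simp [ih, List.sum_map_add]

/-- The sum of `φ (P^c F) (R^c F)` over the admissible cuts `c` of a forest `F`. -/
def cutSum (φ : List (PTree D) → List (PTree D) → M) (F : List (PTree D)) : M :=
  ((admissibleCuts F).map fun c => φ (prunedList c) (trunkList c)).sum

theorem cutSum_eq (φ : List (PTree D) → List (PTree D) → M) (F : List (PTree D)) :
    cutSum φ F = ((cutsList F).map fun c =>
      if maxCutsList c ≤ 1 then φ (prunedList c) (trunkList c) else 0).sum := by
  rw [cutSum, admissibleCuts, sum_map_filter_eq]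

theorem sum_cutsList_cons (d : D) (ts r : List (PTree D)) (f : List (PTree (D × Bool)) → M) :
    ((cutsList (node d ts :: r)).map f).sum =
      ((cutsList ts).map fun us => ((cutsList r).map fun vs => f (node (d, false) us :: vs)).sum +
        ((cutsList r).map fun vs => f (node (d, true) us :: vs)).sum).sum := by
  rw [cutsList, cuts, sum_map_flatMap, sum_map_flatMap]
  simp [Function.comp_def]

/-- A marked root forbids any further mark above it, and exactly one marking of the branches has
none: the total cut is counted once. -/
theorem sum_cutsList_unmarked (F : List (PTree D)) : ∀ f : List (PTree D) → M,
    ((cutsList F).map fun c => if maxCutsList c = 0 then f (unmarkList c) else 0).sum = f F := by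
  induction F using forest_induction with
  | nil => intro f; simp [cutsList, maxCutsList, unmarkList]
  | cons d ts r iht ihr =>
    intro f
    rw [sum_cutsList_cons]
    rw [← iht fun ts => f (node d ts :: r)]
    congr 1
    refine List.map_congr_left fun us _ => ?_
    by_cases h : maxCutsList us = 0
    · simp [maxCutsList, maxCuts, h, unmarkList, unmark,
        ihr fun r => f (node d (unmarkList us) :: r)]
    · simp [maxCutsList, maxCuts, h]

@[simp] theorem cutSum_nil (φ : List (PTree D) → List (PTree D) → M) : cutSum φ [] = φ [] [] := by
  simp [cutSum_eq, cutsList, maxCutsList, prunedList, trunkList]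

theorem cutSum_zero (F : List (PTree D)) : cutSum (fun _ _ => (0 : M)) F = 0 := by
  simp [cutSum]

theorem cutSum_add (φ ψ : List (PTree D) → List (PTree D) → M) (F : List (PTree D)) :
    cutSum (fun p q => φ p q + ψ p q) F = cutSum φ F + cutSum ψ F := by
  simp [cutSum, List.sum_map_add]

theorem cutSum_comm (φ : List (PTree D) → List (PTree D) → List (PTree D) → List (PTree D) → M)
    (F G : List (PTree D)) :
    cutSum (fun p q => cutSum (φ p q) G) F =
      cutSum (fun p' q' => cutSum (fun p q => φ p q p' q') F) G := by
  simp only [cutSum]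
  rw [sum_map_comm]

theorem map_cutSum {N : Type*} [AddCommMonoid N] (f : M →+ N)
    (φ : List (PTree D) → List (PTree D) → M) (F : List (PTree D)) :
    f (cutSum φ F) = cutSum (fun p q => f (φ p q)) F := by
  simp [cutSum, map_list_sum, Function.comp_def]

/-- The coproduct of a forest in terms of those of its first tree's branches and of its tail. -/
theorem cutSum_cons (φ : List (PTree D) → List (PTree D) → M) (d : D) (ts r : List (PTree D)) :
    cutSum φ (node d ts :: r) = cutSum (fun p q => φ (node d ts :: p) q) r +
      cutSum (fun p q => cutSum (fun p' q' => φ (p ++ p') (node d q :: q')) r) ts := by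
  rw [cutSum_eq, sum_cutsList_cons, List.sum_map_add, add_comm]
  congr 1
  · rw [← sum_cutsList_unmarked ts fun ts => cutSum (fun p q => φ (node d ts :: p) q) r]
    congr 1
    refine List.map_congr_left fun us _ => ?_
    by_cases h : maxCutsList us = 0
    · simp [maxCutsList, maxCuts, h, prunedList, pruned, trunkList, trunk, cutSum_eq]
    · simp [maxCutsList, maxCuts, h]
  · rw [cutSum_eq]
    congr 1
    refine List.map_congr_left fun us _ => ?_
    by_cases h : maxCutsList us ≤ 1
    · simp [maxCutsList, maxCuts, h, prunedList, pruned, trunkList, trunk, cutSum_eq]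
    · simp [maxCutsList, maxCuts, h]

theorem cutSum_append (φ : List (PTree D) → List (PTree D) → M) (F G : List (PTree D)) :
    cutSum φ (F ++ G) =
      cutSum (fun p q => cutSum (fun p' q' => φ (p ++ p') (q ++ q')) G) F := by
  induction F generalizing φ with
  | nil => simp
  | cons t r ih =>
    obtain ⟨d, ts⟩ := t
    rw [List.cons_append, cutSum_cons, cutSum_cons]
    simp [ih]

/-- Coassociativity. -/
theorem cutSum_coassoc (F : List (PTree D)) :
    ∀ φ : List (PTree D) → List (PTree D) → List (PTree D) → M,
    cutSum (fun p q => cutSum (fun p₁ p₂ => φ p₁ p₂ q) p) F =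
      cutSum (fun p q => cutSum (fun q₁ q₂ => φ p q₁ q₂) q) F := by
  induction F using forest_induction with
  | nil => intro φ; simp
  | cons d ts r iht ihr =>
    intro φ
    simp only [cutSum_cons, cutSum_append, cutSum_add]
    -- Three terms remain on each side, according to the tensor factor that receives the root. In
    -- the third, both the branches and the tail are cut twice, so both induction hypotheses are
    -- needed.
    rw [ihr fun p₁ p₂ q => φ (node d ts :: p₁) p₂ q, add_assoc]
    congr 1
    congr 1
    · rw [cutSum_comm]
      refine congrArg (cutSum · ts) (funext₂ fun a b => ?_)
      exact ihr fun p₁ p₂ q => φ (a ++ p₁) (node d b :: p₂) q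
    · have key := iht fun a b c => cutSum (fun p q => cutSum (fun q₁ q₂ =>
        φ (a ++ p) (b ++ q₁) (node d c :: q₂)) q) r
      simp only [cutSum_comm (G := r)] at key ⊢
      rw [← key]
      have h := ihr fun x y z => cutSum (fun p q => cutSum (fun u v =>
        φ (u ++ x) (v ++ y) (node d q :: z)) p) ts
      convert h using 4 with p' q' p' q'
      · rw [cutSum_comm]
        exact congrArg (cutSum · ts) (funext₂ fun a b => cutSum_comm _ _ _)
      · rw [cutSum_comm]
        exact congrArg (cutSum · ts) (funext₂ fun a b => cutSum_comm _ _ _)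

-- The grading by decorations and the counit

/-- The multiset of the decorations of a forest. -/
def degree : List (PTree D) → Multiset D
  | [] => 0
  | node d ts :: r => d ::ₘ (degree ts + degree r)

@[simp] theorem degree_nil : degree ([] : List (PTree D)) = 0 := by rw [degree]

@[simp] theorem degree_node_cons (d : D) (ts r : List (PTree D)) :
    degree (node d ts :: r) = d ::ₘ (degree ts + degree r) := by rw [degree]

@[simp] theorem degree_append (F G : List (PTree D)) : degree (F ++ G) = degree F + degree G := by
  induction F with
  | nil => simp
  | cons t r ih => obtain ⟨d, ts⟩ := t; simp [ih, add_assoc]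

theorem degree_eq_zero {F : List (PTree D)} : degree F = 0 ↔ F = [] := by
  rcases F with _ | ⟨⟨d, ts⟩, r⟩ <;> simp

theorem degree_getLast_dropLast {F : List (PTree D)} {t : PTree D} (h : F.getLast? = some t) :
    degree F = degree F.dropLast + degree [t] := by
  rw [← degree_append, List.dropLast_append_getLast? t (by simp [h])]

/-- There are finitely many forests with given decorations. -/
theorem finite_degree_eq (m : Multiset D) : {F : List (PTree D) | degree F = m}.Finite := by
  classical
  -- The induction runs on the number of vertices; the bound by `m` stays fixed and confines the
  -- root decoration to a finite set, since `D` may be infinite.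
  have key : ∀ n : ℕ, {F : List (PTree D) | degree F ≤ m ∧ (degree F).card ≤ n}.Finite := by
    intro n
    induction n with
    | zero =>
      refine (Set.finite_singleton []).subset fun F hF => ?_
      simpa [degree_eq_zero] using hF.2
    | succ n ih =>
      refine ((Set.finite_singleton []).union (Set.Finite.image2
        (fun d (x : List (PTree D) × List (PTree D)) => node d x.1 :: x.2)
        m.toFinset.finite_toSet (ih.prod ih))).subset fun F hF => ?_
      rcases F with _ | ⟨⟨d, ts⟩, r⟩
      · simp
      · obtain ⟨h₁, h₂⟩ := hF
        simp only [degree_node_cons, Multiset.card_cons, Multiset.card_add] at h₁ h₂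
        have h := (Multiset.le_cons_self _ d).trans h₁
        refine Or.inr ⟨d, by simpa using Multiset.mem_of_le h₁ (Multiset.mem_cons_self _ _),
          (ts, r), ⟨⟨(Multiset.le_add_right _ _).trans h, ?_⟩,
            (Multiset.le_add_left _ _).trans h, ?_⟩, rfl⟩ <;> dsimp only <;> omega
  exact (key m.card).subset fun F hF => by
    rw [Set.mem_ofPred_eq] at hF ⊢
    simp [hF]

/-- Cuts preserve the degree, so that only pairs of forests of the right degree matter. -/
theorem cutSum_congr (F : List (PTree D)) : ∀ {φ ψ : List (PTree D) → List (PTree D) → M},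
    (∀ p q, degree p + degree q = degree F → φ p q = ψ p q) → cutSum φ F = cutSum ψ F := by
  induction F using forest_induction with
  | nil => intro φ ψ h; simpa using h [] [] (by simp)
  | cons d ts r iht ihr =>
    intro φ ψ h
    rw [cutSum_cons, cutSum_cons]
    congr 1
    · exact ihr fun p q hpq => h _ _ (by simp [← hpq, add_assoc])
    · refine iht fun p q hpq => ihr fun p' q' hpq' => h _ _ ?_
      simp only [degree_append, degree_node_cons, ← hpq, ← hpq', Multiset.add_cons]
      congr 1
      abel

/-- The counit on the right. -/
theorem cutSum_of_right (F : List (PTree D)) : ∀ {φ : List (PTree D) → List (PTree D) → M},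
    (∀ p q, q ≠ [] → φ p q = 0) → cutSum φ F = φ F [] := by
  induction F using forest_induction with
  | nil => intro φ h; simp
  | cons d ts r iht ihr =>
    intro φ h
    rw [cutSum_cons, ihr fun p q hq => h _ _ hq]
    simp [h, cutSum_zero]

/-- The counit on the left. -/
theorem cutSum_of_left (F : List (PTree D)) : ∀ {φ : List (PTree D) → List (PTree D) → M},
    (∀ p q, p ≠ [] → φ p q = 0) → cutSum φ F = φ [] F := by
  induction F using forest_induction with
  | nil => intro φ h; simp
  | cons d ts r iht ihr =>
    intro φ h
    have h₁ : cutSum (fun p q => φ (node d ts :: p) q) r = 0 := by simp [h, cutSum_zero]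
    rw [cutSum_cons, h₁, zero_add, iht, ihr]
    · simp
    · intro p q hp; exact h _ _ (by simp [hp])
    · intro p q hp; simp [h, hp, cutSum_zero]

end PTree

-- The integral pairing of forests

namespace PTree

variable {D : Type*}

theorem mul_cutSum {R : Type*} [NonUnitalNonAssocSemiring R] (a : R)
    (φ : List (PTree D) → List (PTree D) → R) (F : List (PTree D)) :
    a * cutSum φ F = cutSum (fun p q => a * φ p q) F :=
  map_cutSum (AddMonoidHom.mulLeft a) φ F

theorem cutSum_mul {R : Type*} [NonUnitalNonAssocSemiring R] (a : R)
    (φ : List (PTree D) → List (PTree D) → R) (F : List (PTree D)) :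
    cutSum φ F * a = cutSum (fun p q => φ p q * a) F :=
  map_cutSum (AddMonoidHom.mulRight a) φ F

open Classical in
/-- The transpose of `γ_d`, on functions of forests. -/
noncomputable def gammaDual {R : Type*} [Zero R] (d : D) (f : List (PTree D) → R)
    (G : List (PTree D)) : R :=
  if G.getLast? = some (dot d) then f G.dropLast else 0

open Classical in
theorem gammaDual_append {R : Type*} [Zero R] (d d' : D) (f : List (PTree D) → R)
    (G K : List (PTree D)) :
    gammaDual d f (G ++ [node d' K]) = if d' = d ∧ K = [] then f G else 0 := by
  simp [gammaDual, dot]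

/-- The pairing of two forests. -/
noncomputable def pair : List (PTree D) → List (PTree D) → ℤ
  | [] => fun G => if G = [] then 1 else 0
  | node d ts :: r => cutSum fun p q => gammaDual d (pair ts) p * pair r q

theorem pair_nil (G : List (PTree D)) : pair [] G = if G = [] then 1 else 0 := by
  rw [pair]

theorem pair_cons (d : D) (ts r G : List (PTree D)) : pair (node d ts :: r) G =
    cutSum (fun p q => gammaDual d (pair ts) p * pair r q) G := by
  rw [pair]

theorem pair_node (d : D) (ts G : List (PTree D)) :
    pair [node d ts] G = gammaDual d (pair ts) G := by
  rw [pair_cons, cutSum_of_right]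
  · simp [pair_nil]
  · intro p q hq; simp [pair_nil, hq]

/-- The recursion splits off only the first tree; coassociativity moves the splitting point to any
place. -/
theorem pair_append (F F' G : List (PTree D)) :
    pair (F ++ F') G = cutSum (fun p q => pair F p * pair F' q) G := by
  induction F generalizing G with
  | nil =>
    rw [cutSum_of_left]
    · simp [pair_nil]
    · intro p q hp; simp [pair_nil, hp]
  | cons t r ih =>
    obtain ⟨d, ts⟩ := t
    simp only [List.cons_append, pair_cons, ih, mul_cutSum, cutSum_mul]
    rw [cutSum_coassoc G fun a b c => gammaDual d (pair ts) a * pair r b * pair F' c]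
    simp only [mul_assoc]

/-- Cuts preserve the decorations, and `γ_d` removes the decoration `d` that grafting adds. -/
theorem pair_eq_zero (F : List (PTree D)) :
    ∀ G, degree F ≠ degree G → pair F G = 0 := by
  induction F using forest_induction with
  | nil =>
    intro G h
    rw [pair_nil, if_neg]
    rintro rfl
    exact h rfl
  | cons d ts r iht ihr =>
    intro G h
    rw [pair_cons, ← cutSum_zero G]
    refine cutSum_congr G fun p q hpq => ?_
    by_cases hq : degree r = degree q
    · rw [gammaDual]
      split_ifs with hp
      · rw [iht, zero_mul]
        intro ht
        apply h
        rw [← hpq, degree_getLast_dropLast hp, ← ht, ← hq, dot]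
        rw [degree_node_cons, degree_node_cons, degree_nil, add_zero, Multiset.add_cons,
          add_zero, Multiset.cons_add]
      · simp
    · rw [ihr q hq, mul_zero]

end PTree

-- Existence and uniqueness of the bilinear form

noncomputable section

namespace HPR

open PTree

variable {D : Type*}

/-- A forest given as a list of trees, seen as a monomial of the free algebra. -/
def monomial (F : List (PTree D)) : HPR D := forest (FreeMonoid.ofList F)

theorem forest_eq (F : PForest D) : forest F = monomial F.toList := rfl

theorem forestBasis_ofList (F : List (PTree D)) :
    forestBasis D (FreeMonoid.ofList F) = monomial F := forestBasis_apply _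

@[simp] theorem monomial_nil : monomial ([] : List (PTree D)) = 1 := map_one forest

theorem monomial_append (F G : List (PTree D)) :
    monomial (F ++ G) = monomial F * monomial G := by
  rw [monomial, FreeMonoid.ofList_append, map_mul]; rfl

theorem monomial_singleton (t : PTree D) : monomial [t] = FreeAlgebra.ι ℚ t :=
  FreeMonoid.lift_eval_of _ t

theorem monomial_induction {P : HPR D → Prop} (monomial : ∀ F, P (monomial F))
    (add : ∀ x y, P x → P y → P (x + y)) (smul : ∀ (c : ℚ) x, P x → P (c • x)) (x : HPR D) :
    P x := by
  have hx := (forestBasis D).mem_span x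
  induction hx using Submodule.span_induction with
  | mem x h =>
    obtain ⟨F, rfl⟩ := h
    rw [forestBasis_apply]
    exact monomial F.toList
  | zero => simpa using smul 0 _ (monomial [])
  | add x y _ _ hx hy => exact add x y hx hy
  | smul c x _ hx => exact smul c x hx

theorem coproduct_monomial (F : List (PTree D)) :
    coproduct (monomial F) = cutSum (fun p q => monomial p ⊗ₜ[ℚ] monomial q) F := by
  rw [coproduct, ← forestBasis_ofList, Module.Basis.constr_basis]
  rfl

theorem counit_monomial (F : List (PTree D)) :
    counit (monomial F) = if F = [] then 1 else 0 := by
  rw [counit, ← forestBasis_ofList, Module.Basis.constr_basis]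
  by_cases h : F = []
  · rw [if_pos h]; exact if_pos h
  · rw [if_neg h]; exact if_neg h

theorem graft_monomial (d : D) (F : List (PTree D)) :
    graft d (monomial F) = monomial [node d F] := by
  rw [graft, ← forestBasis_ofList, Module.Basis.constr_basis, monomial_singleton]
  rfl

theorem map_gamma_monomial {M : Type*} [AddCommMonoid M] [Module ℚ M] (f : HPR D →ₗ[ℚ] M) (d : D)
    (F : List (PTree D)) :
    f (gamma d (monomial F)) = gammaDual d (fun G => f (monomial G)) F := by
  rw [gamma, ← forestBasis_ofList, Module.Basis.constr_basis, gammaDual, FreeMonoid.toList_ofList,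
    apply_ite f, map_zero]
  rfl

theorem mul'_map_coproduct_monomial (f g : HPR D →ₗ[ℚ] ℚ) (F : List (PTree D)) :
    LinearMap.mul' ℚ ℚ (TensorProduct.map f g (coproduct (monomial F))) =
      cutSum (fun p q => f (monomial p) * g (monomial q)) F := by
  rw [coproduct_monomial]
  exact map_cutSum ((LinearMap.mul' ℚ ℚ) ∘ₗ (TensorProduct.map f g)).toAddMonoidHom _ _

/-- The pairing. -/
def pairing : HPR D →ₗ[ℚ] HPR D →ₗ[ℚ] ℚ :=
  (forestBasis D).constr ℚ fun F => (forestBasis D).constr ℚ fun G => (pair F.toList G.toList : ℚ)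

theorem pairing_monomial (F G : List (PTree D)) :
    pairing (monomial F) (monomial G) = pair F G := by
  rw [pairing, ← forestBasis_ofList, Module.Basis.constr_basis, ← forestBasis_ofList,
    Module.Basis.constr_basis]
  rfl

theorem intCast_gammaDual (d : D) (f : List (PTree D) → ℤ) (G : List (PTree D)) :
    ((gammaDual d f G : ℤ) : ℚ) = gammaDual d (fun F => (f F : ℚ)) G := by
  simp [gammaDual]

theorem intCast_cutSum (φ : List (PTree D) → List (PTree D) → ℤ) (G : List (PTree D)) :
    ((cutSum φ G : ℤ) : ℚ) = cutSum (fun p q => (φ p q : ℚ)) G :=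
  map_cutSum (Int.castAddHom ℚ) φ G

theorem isPairing_pairing : IsPairing (pairing (D := D)) where
  one_left x := by
    induction x using monomial_induction with
    | monomial F => rw [← monomial_nil, pairing_monomial, counit_monomial, pair_nil]; simp
    | add x y hx hy => simp [hx, hy]
    | smul c x hx => simp [hx]
  mul_left x₁ x₂ y := by
    induction y using monomial_induction with
    | add x y hx hy => simp only [map_add, hx, hy]
    | smul c x hx => simp only [map_smul, hx]
    | monomial G =>
      induction x₁ using monomial_induction with
      | add x y hx hy => simp only [add_mul, map_add, LinearMap.add_apply, hx, hy,
          TensorProduct.map_add_left]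
      | smul c x hx => simp only [smul_mul_assoc, map_smul, LinearMap.smul_apply, hx,
          TensorProduct.map_smul_left]
      | monomial F =>
        induction x₂ using monomial_induction with
        | add x y hx hy => simp only [mul_add, map_add, LinearMap.add_apply, hx, hy,
            TensorProduct.map_add_right]
        | smul c x hx => simp only [mul_smul_comm, map_smul, LinearMap.smul_apply, hx,
            TensorProduct.map_smul_right]
        | monomial F' =>
          rw [← monomial_append, pairing_monomial, pair_append, intCast_cutSum,
            mul'_map_coproduct_monomial]
          simp only [pairing_monomial, Int.cast_mul]
  graft_left d x y := by
    induction y using monomial_induction with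
    | add x y hx hy => simp only [map_add, hx, hy]
    | smul c x hx => simp only [map_smul, hx]
    | monomial G =>
      induction x using monomial_induction with
      | add x y hx hy => simp only [map_add, LinearMap.add_apply, hx, hy]
      | smul c x hx => simp only [map_smul, LinearMap.smul_apply, hx]
      | monomial F =>
        rw [graft_monomial, pairing_monomial, pair_node, map_gamma_monomial, intCast_gammaDual]
        simp only [pairing_monomial]

namespace IsPairing

variable {β : HPR D →ₗ[ℚ] HPR D →ₗ[ℚ] ℚ}

theorem mul_monomial (hβ : IsPairing β) (x y : HPR D) (F : List (PTree D)) :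
    β (x * y) (monomial F) = cutSum (fun p q => β x (monomial p) * β y (monomial q)) F := by
  rw [hβ.mul_left, mul'_map_coproduct_monomial]

theorem graft_monomial (hβ : IsPairing β) (d : D) (x : HPR D) (F : List (PTree D)) :
    β (graft d x) (monomial F) = gammaDual d (fun G => β x (monomial G)) F := by
  rw [hβ.graft_left, map_gamma_monomial]

theorem apply_monomial (hβ : IsPairing β) (F : List (PTree D)) :
    ∀ G, β (monomial F) (monomial G) = pair F G := by
  induction F using forest_induction with
  | nil => intro G; rw [monomial_nil, hβ.one_left, counit_monomial, pair_nil]; simp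
  | cons d ts r iht ihr =>
    intro G
    rw [← List.singleton_append, monomial_append, hβ.mul_monomial, ← HPR.graft_monomial,
      pair_append, intCast_cutSum]
    simp only [hβ.graft_monomial, ihr, iht, pair_node, intCast_gammaDual, Int.cast_mul]

theorem eq_pairing (hβ : IsPairing β) : β = pairing := by
  refine (forestBasis D).ext fun F => (forestBasis D).ext fun G => ?_
  rw [forestBasis_apply, forestBasis_apply, forest_eq, forest_eq, hβ.apply_monomial,
    pairing_monomial]

end IsPairing

end HPR

end

-- Integral homogeneous elements and the subring generated by the trees

noncomputable section

namespace HPR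

open PTree

variable {D : Type*}

/-- The integral combinations of the forests of degree `m`. -/
def homogeneous (m : Multiset D) : Submodule ℤ (HPR D) :=
  Submodule.span ℤ (monomial '' {F | degree F = m})

theorem monomial_mem_homogeneous (F : List (PTree D)) : monomial F ∈ homogeneous (degree F) :=
  Submodule.subset_span ⟨F, rfl, rfl⟩

theorem mul_mem_homogeneous {m n : Multiset D} {x y : HPR D} (hx : x ∈ homogeneous m)
    (hy : y ∈ homogeneous n) : x * y ∈ homogeneous (m + n) := by
  induction hx using Submodule.span_induction with
  | mem x h =>
    obtain ⟨F, rfl, rfl⟩ := h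
    induction hy using Submodule.span_induction with
    | mem y h =>
      obtain ⟨G, rfl, rfl⟩ := h
      rw [← monomial_append, ← degree_append]
      exact monomial_mem_homogeneous _
    | zero => rw [mul_zero]; exact zero_mem _
    | add x y _ _ hx hy => rw [mul_add]; exact add_mem hx hy
    | smul c x _ hx => rw [mul_smul_comm]; exact Submodule.smul_mem _ c hx
  | zero => rw [zero_mul]; exact zero_mem _
  | add x y _ _ hx hy => rw [add_mul]; exact add_mem hx hy
  | smul c x _ hx => rw [smul_mul_assoc]; exact Submodule.smul_mem _ c hx

theorem graft_mem_homogeneous (d : D) {m : Multiset D} {x : HPR D} (hx : x ∈ homogeneous m) :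
    graft d x ∈ homogeneous (d ::ₘ m) := by
  induction hx using Submodule.span_induction with
  | mem x h =>
    obtain ⟨F, rfl, rfl⟩ := h
    rw [graft_monomial]
    exact Submodule.subset_span ⟨_, by simp, rfl⟩
  | zero => simp
  | add x y _ _ hx hy => rw [map_add]; exact add_mem hx hy
  | smul c x _ hx => rw [map_zsmul]; exact Submodule.smul_mem _ c hx

theorem eq_sum_of_mem_homogeneous {m : Multiset D} {x : HPR D} (hx : x ∈ homogeneous m) :
    x = ∑ F ∈ (finite_degree_eq m).toFinset,
      (forestBasis D).repr x (FreeMonoid.ofList F) • monomial F := by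
  classical
  induction hx using Submodule.span_induction with
  | mem x h =>
    obtain ⟨F, hF, rfl⟩ := h
    rw [Finset.sum_eq_single F]
    · rw [← forestBasis_ofList, Module.Basis.repr_self, Finsupp.single_eq_same, one_smul]
    · intro G _ hG
      rw [← forestBasis_ofList, Module.Basis.repr_self, Finsupp.single_eq_of_ne, zero_smul]
      exact hG
    · intro h
      exact absurd ((Set.Finite.mem_toFinset _).2 hF) h
  | zero => simp
  | add x y _ _ hx hy =>
    simp only [map_add, Finsupp.add_apply, add_smul, Finset.sum_add_distrib]
    rw [← hx, ← hy]
  | smul c x _ hx =>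
    simp only [map_zsmul, Finsupp.smul_apply, smul_assoc, ← Finset.smul_sum]
    rw [← hx]

theorem monomial_mem_APR (F : List (PTree D)) : monomial F ∈ APR D := by
  induction F with
  | nil => rw [monomial_nil]; exact one_mem _
  | cons t F ih =>
    rw [← List.singleton_append, monomial_append, monomial_singleton]
    exact mul_mem (Subring.subset_closure ⟨t, rfl⟩) ih

theorem mem_APR_of_mem_homogeneous {m : Multiset D} {x : HPR D} (hx : x ∈ homogeneous m) :
    x ∈ APR D := by
  induction hx using Submodule.span_induction with
  | mem x h => obtain ⟨F, -, rfl⟩ := h; exact monomial_mem_APR F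
  | zero => exact zero_mem _
  | add x y _ _ hx hy => exact add_mem hx hy
  | smul c x _ hx => exact zsmul_mem hx c

/-- Induction for the integral combinations of forests. -/
theorem APR_induction {P : HPR D → Prop} (monomial : ∀ F, P (monomial F)) (zero : P 0)
    (add : ∀ x y, P x → P y → P (x + y)) (neg : ∀ x, P x → P (-x)) {x : HPR D}
    (hx : x ∈ APR D) : P x := by
  -- The subring is the additive closure of the submonoid generated by the trees, which consists of
  -- the forests.
  rw [APR, Subring.mem_closure_iff, ← FreeMonoid.mrange_lift] at hx
  induction hx using AddSubgroup.closure_induction with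
  | mem x h => obtain ⟨F, rfl⟩ := h; exact monomial F.toList
  | zero => exact zero
  | add x y _ _ hx hy => exact add x y hx hy
  | neg x _ hx => exact neg x hx

theorem exists_counit_eq_intCast {x : HPR D} (hx : x ∈ APR D) : ∃ n : ℤ, counit x = n := by
  refine APR_induction (P := fun x => ∃ n : ℤ, counit x = n)
    (fun F => ⟨if F = [] then 1 else 0, by simp [counit_monomial]⟩) ⟨0, by simp⟩ ?_ ?_ hx
  · rintro x y ⟨m, hm⟩ ⟨n, hn⟩
    exact ⟨m + n, by simp [hm, hn]⟩
  · rintro x ⟨m, hm⟩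
    exact ⟨-m, by simp [hm]⟩

theorem coproduct_mem_closure {x : HPR D} (hx : x ∈ APR D) :
    coproduct x ∈ AddSubgroup.closure {z | ∃ a ∈ APR D, ∃ b ∈ APR D, z = a ⊗ₜ[ℚ] b} := by
  refine APR_induction (P := fun x => coproduct x ∈ AddSubgroup.closure
    {z | ∃ a ∈ APR D, ∃ b ∈ APR D, z = a ⊗ₜ[ℚ] b}) (fun F => ?_) ?_ ?_ ?_ hx
  · rw [coproduct_monomial, cutSum]
    refine list_sum_mem fun z hz => ?_
    obtain ⟨c, -, rfl⟩ := List.mem_map.1 hz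
    exact AddSubgroup.subset_closure
      ⟨_, monomial_mem_APR _, _, monomial_mem_APR _, rfl⟩
  · rw [map_zero]; exact zero_mem _
  · intro x y hx hy; rw [map_add]; exact add_mem hx hy
  · intro x hx; rw [map_neg]; exact neg_mem hx

-- Dual elements and their triangular construction

/-- The element `x` pairs with the forests as the coordinate form of the forest `F`. -/
def IsDualTo (β : HPR D →ₗ[ℚ] HPR D →ₗ[ℚ] ℚ) (F : List (PTree D)) (x : HPR D) : Prop :=
  ∀ G, (F = G → β x (monomial G) = 1) ∧ (F ≠ G → β x (monomial G) = 0)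

/-- The expansion of a forest in a homogeneous dual family. -/
theorem monomial_eq_sum {β : HPR D →ₗ[ℚ] HPR D →ₗ[ℚ] ℚ} {e : List (PTree D) → HPR D}
    (he : ∀ F, e F ∈ homogeneous (degree F)) (hd : ∀ F, IsDualTo β F (e F)) (G : List (PTree D)) :
    monomial G = ∑ F ∈ (finite_degree_eq (degree G)).toFinset,
      β (monomial G) (monomial F) • e F := by
  classical
  set S := (finite_degree_eq (degree G)).toFinset with hS
  have mem_S : ∀ F, F ∈ S ↔ degree F = degree G := by simp [hS]
  let E : Matrix S S ℚ := fun F H => (forestBasis D).repr (e F) (FreeMonoid.ofList H.1)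
  let B : Matrix S S ℚ := fun F H => β (monomial F.1) (monomial H.1)
  have hE : ∀ F : S, e F = ∑ H : S, E F H • monomial H.1 := by
    intro F
    rw [Finset.sum_coe_sort S fun H => (forestBasis D).repr (e F) (FreeMonoid.ofList H) •
      monomial H]
    have := eq_sum_of_mem_homogeneous (he F)
    rwa [(mem_S F).1 F.2] at this
  have hEB : E * B = 1 := by
    ext F H
    have h : β (e F) (monomial H.1) = (E * B) F H := by
      rw [hE F, Matrix.mul_apply]
      simp [B]
    rw [← h, Matrix.one_apply]
    split_ifs with hFH
    · exact (hd F H).1 (congrArg _ hFH)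
    · exact (hd F H).2 fun h => hFH (Subtype.ext h)
  -- Both matrices are square and finite, so the left inverse of the Gram matrix is a right inverse;
  -- row `G` of this identity is the expansion.
  have hBE : B * E = 1 := mul_eq_one_comm.1 hEB
  rw [← Finset.sum_coe_sort S fun F => β (monomial G) (monomial F) • e F]
  have hG : G ∈ S := (mem_S G).2 rfl
  calc monomial G = ∑ H : S, (1 : Matrix S S ℚ) ⟨G, hG⟩ H • monomial H.1 := by
        simp [Matrix.one_apply, ite_smul]
    _ = ∑ H : S, ∑ F : S, (B ⟨G, hG⟩ F * E F H) • monomial H.1 := by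
        simp only [← hBE, Matrix.mul_apply, Finset.sum_smul]
    _ = _ := by
        rw [Finset.sum_comm]
        refine Finset.sum_congr rfl fun F _ => ?_
        rw [hE F, Finset.smul_sum]
        simp only [mul_smul, B]

namespace IsPairing

variable {β : HPR D →ₗ[ℚ] HPR D →ₗ[ℚ] ℚ}

theorem exists_apply_eq_intCast (hβ : IsPairing β) {x : HPR D} (hx : x ∈ APR D)
    (G : List (PTree D)) : ∃ n : ℤ, β x (monomial G) = n := by
  refine APR_induction (P := fun x => ∃ n : ℤ, β x (monomial G) = n)
    (fun F => ⟨_, hβ.apply_monomial F G⟩) ⟨0, by simp⟩ ?_ ?_ hx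
  · rintro x y ⟨m, hm⟩ ⟨n, hn⟩
    exact ⟨m + n, by simp [hm, hn]⟩
  · rintro x ⟨m, hm⟩
    exact ⟨-m, by simp [hm]⟩

theorem apply_eq_zero_of_mem_homogeneous (hβ : IsPairing β) {m : Multiset D} {x : HPR D}
    (hx : x ∈ homogeneous m) {G : List (PTree D)} (hG : degree G ≠ m) :
    β x (monomial G) = 0 := by
  induction hx using Submodule.span_induction with
  | mem x h =>
    obtain ⟨F, rfl, rfl⟩ := h
    rw [hβ.apply_monomial, pair_eq_zero F G (Ne.symm hG), Int.cast_zero]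
  | zero => simp
  | add x y _ _ hx hy => simp [hx, hy]
  | smul c x _ hx => rw [map_zsmul, LinearMap.smul_apply, hx, smul_zero]

/-- If `x` and `y` are dual to `G` and `F`, then `x B_d^+(y)` is dual to `F B_d^+(G)`, as far as
forests whose last tree is not smaller than `B_d^+(G)` are concerned. -/
theorem mul_graft_apply (hβ : IsPairing β) {F G : List (PTree D)} {x y : HPR D} (d : D)
    (hx : IsDualTo β G x) (hy : IsDualTo β F y) (H K : List (PTree D)) (d' : D)
    (hK : (degree G).card ≤ (degree K).card) :
    (F ++ [node d G] = H ++ [node d' K] →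
      β (x * graft d y) (monomial (H ++ [node d' K])) = 1) ∧
    (F ++ [node d G] ≠ H ++ [node d' K] →
      β (x * graft d y) (monomial (H ++ [node d' K])) = 0) := by
  classical
  -- The last tree cannot be cut off whole: with its root it has more vertices than `G`.
  have h₁ : ∀ p, β x (monomial (p ++ [node d' K])) = 0 := fun p => (hx _).2 fun h => by
    have := congrArg (Multiset.card ∘ degree) h
    simp at this
    omega
  -- Once all of `K` is cut off, there is no room in `G` for a piece of `H`.
  have h₂ : ∀ p, p ≠ [] → β x (monomial (p ++ K)) = 0 := fun p hp => (hx _).2 fun h => by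
    have := congrArg (Multiset.card ∘ degree) h
    have hp' : 0 < (degree p).card := Multiset.card_pos.2 fun h => hp (degree_eq_zero.1 h)
    simp at this
    omega
  -- Since `γ_d` wants a bare last root, `K` must be cut off entirely; the one cut left has `P^c =
  -- K` and `R^c = H` followed by a single vertex.
  have h₃ : β (x * graft d y) (monomial (H ++ [node d' K])) =
      if d' = d then β x (monomial K) * β y (monomial H) else 0 := by
    rw [hβ.mul_monomial, cutSum_append]
    simp only [cutSum_cons, cutSum_nil, h₁, zero_mul, zero_add, List.append_nil,
      hβ.graft_monomial, gammaDual_append]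
    rw [cutSum_of_left]
    · rw [cutSum_of_right]
      · simp
      · intro p q hq; simp [hq]
    · intro p q hp
      rw [cutSum_of_right]
      · simp [h₂ p hp]
      · intro p q hq; simp [hq]
  rw [h₃]
  constructor
  · intro h
    obtain ⟨rfl, h⟩ := List.append_inj' h rfl
    obtain ⟨rfl, rfl⟩ : d = d' ∧ G = K := by simpa using h
    rw [if_pos rfl, (hx _).1 rfl, (hy _).1 rfl, one_mul]
  · intro h
    split_ifs with hd
    · subst hd
      by_cases hG : G = K
      · subst hG
        rw [(hy H).2 fun hF => h (by rw [hF]), mul_zero]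
      · rw [(hx K).2 hG, zero_mul]
    · rfl

/-- No correction is needed here: `γ_d` inverts right multiplication by the one-vertex tree and
kills all other forests. -/
theorem graft_dual (hβ : IsPairing β) {F : List (PTree D)} {y : HPR D} (d : D)
    (hy : IsDualTo β F y) : IsDualTo β (F ++ [dot d]) (graft d y) := by
  intro H
  rw [hβ.graft_monomial, gammaDual]
  constructor
  · rintro rfl
    simp [(hy F).1]
  · intro h
    split_ifs with hH
    · refine (hy _).2 fun hF => h ?_
      rw [hF, List.dropLast_append_getLast? _ (by simp [hH])]
    · rfl

/-- Subtracting suitable multiples of dual elements, an element that has pairing `1` with `F`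
becomes dual to `F`. -/
theorem exists_dual_of_lower (hβ : IsPairing β) {F : List (PTree D)} {w : HPR D}
    (hw : w ∈ homogeneous (degree F)) (hF : β w (monomial F) = 1)
    (h : ∀ G, degree G = degree F → G ≠ F → β w (monomial G) ≠ 0 →
      ∃ x ∈ homogeneous (degree G), IsDualTo β G x) :
    ∃ x ∈ homogeneous (degree F), IsDualTo β F x := by
  classical
  -- The correction attached to `G` is an integral multiple of its dual element, or zero where
  -- nothing needs correcting, so no dual element is required there.
  have key : ∀ G, ∃ z ∈ homogeneous (degree F), ∀ H, β z (monomial H) =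
      if G = H ∧ degree G = degree F ∧ G ≠ F then β w (monomial G) else 0 := by
    intro G
    by_cases hG : degree G = degree F ∧ G ≠ F ∧ β w (monomial G) ≠ 0
    · obtain ⟨x, hx, hxG⟩ := h G hG.1 hG.2.1 hG.2.2
      obtain ⟨n, hn⟩ := hβ.exists_apply_eq_intCast (mem_APR_of_mem_homogeneous hw) G
      refine ⟨n • x, Submodule.smul_mem _ n (hG.1 ▸ hx), fun H => ?_⟩
      rw [map_zsmul, LinearMap.smul_apply, hn]
      by_cases hH : G = H
      · rw [(hxG H).1 hH, if_pos ⟨hH, hG.1, hG.2.1⟩]; simp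
      · rw [(hxG H).2 hH, if_neg fun h => hH h.1, smul_zero]
    · refine ⟨0, zero_mem _, fun H => ?_⟩
      rw [map_zero, LinearMap.zero_apply]
      split_ifs with hH
      · by_contra h0
        exact hG ⟨hH.2.1, hH.2.2, Ne.symm h0⟩
      · rfl
  choose z hz hzH using key
  refine ⟨w - ∑ G ∈ (finite_degree_eq (degree F)).toFinset, z G,
    sub_mem hw (sum_mem fun G _ => hz G), fun H => ?_⟩
  have hsum : β (w - ∑ G ∈ (finite_degree_eq (degree F)).toFinset, z G) (monomial H) =
      β w (monomial H) - if degree H = degree F ∧ H ≠ F then β w (monomial H) else 0 := by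
    simp only [map_sub, map_sum, LinearMap.sub_apply, LinearMap.sum_apply, hzH, ite_and]
    rw [Finset.sum_ite_eq']
    simp only [Set.Finite.mem_toFinset]
    by_cases h : degree H = degree F <;> simp [h]
  rw [hsum]
  constructor
  · rintro rfl
    simp [hF]
  · intro hFH
    by_cases hH : degree H = degree F
    · rw [if_pos ⟨hH, hFH.symm⟩, sub_self]
    · rw [if_neg fun h => hH h.1, sub_zero, hβ.apply_eq_zero_of_mem_homogeneous hw hH]

/-- Every forest has an integral dual element. -/
theorem exists_dual (hβ : IsPairing β) (F : List (PTree D)) :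
    ∃ x ∈ homogeneous (degree F), IsDualTo β F x := by
  induction hn : (degree F).card using Nat.strong_induction_on generalizing F with
  | _ n ih =>
  rcases List.eq_nil_or_concat F with rfl | ⟨F, t, rfl⟩
  · refine ⟨1, by simpa using monomial_mem_homogeneous ([] : List (PTree D)), fun G => ?_⟩
    rw [hβ.one_left, counit_monomial]
    exact ⟨fun h => if_pos h.symm, fun h => if_neg h.symm⟩
  obtain ⟨d, G⟩ := t
  rw [List.concat_eq_append] at *
  -- The outer induction on the number of vertices supplies duals of `F` and `G`; this inner one, on
  -- the size of the last tree, supplies the corrections.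
  induction hk : (degree G).card using Nat.strong_induction_on generalizing F d G with
  | _ k ihk =>
  subst hk
  have hcard : n = (degree F).card + (degree G).card + 1 := by
    rw [← hn]; simp [add_assoc]
  have hdeg : degree (F ++ [node d G]) = degree G + (d ::ₘ degree F) := by
    simp [Multiset.add_cons, add_comm]
  obtain ⟨y, hy, hyF⟩ := ih _ (by omega) F rfl
  by_cases hG : G = []
  · subst hG
    exact ⟨graft d y, by simpa [hdeg] using graft_mem_homogeneous d hy, hβ.graft_dual d hyF⟩
  obtain ⟨x, hx, hxG⟩ := ih _ (by omega) G rfl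
  have hw := mul_mem_homogeneous hx (graft_mem_homogeneous d hy)
  rw [← hdeg] at hw
  refine hβ.exists_dual_of_lower hw ((hβ.mul_graft_apply d hxG hyF F G d le_rfl).1 rfl) ?_
  intro H hH hne h0
  rcases List.eq_nil_or_concat H with rfl | ⟨H, ⟨d', K⟩, rfl⟩
  · simp at hH
  · rw [List.concat_eq_append] at *
    refine ihk _ ?_ H d' K (by rw [hH, hn]) rfl
    -- If the last tree of `H` were at least as large, the pairing would vanish, against `h0`.
    by_contra hK
    exact h0 ((hβ.mul_graft_apply d hxG hyF H K d' (not_lt.1 hK)).2 hne.symm)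

/-- The expansion of an element in a homogeneous dual family. -/
theorem exists_eq_sum (hβ : IsPairing β) {e : List (PTree D) → HPR D}
    (he : ∀ F, e F ∈ homogeneous (degree F)) (hd : ∀ F, IsDualTo β F (e F)) (x : HPR D) :
    ∃ S : Finset (List (PTree D)), ∀ T, S ⊆ T → x = ∑ F ∈ T, β x (monomial F) • e F := by
  classical
  induction x using monomial_induction with
  | monomial G =>
    refine ⟨(finite_degree_eq (degree G)).toFinset, fun T hT => ?_⟩
    rw [← Finset.sum_subset hT, ← monomial_eq_sum he hd]
    intro F _ hF
    rw [hβ.apply_eq_zero_of_mem_homogeneous (monomial_mem_homogeneous G), zero_smul]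
    simpa using hF
  | add x y hx hy =>
    obtain ⟨⟨S, hS⟩, S', hS'⟩ := And.intro hx hy
    -- Validity over every larger set lets both expansions use the same `T`.
    refine ⟨S ∪ S', fun T hT => ?_⟩
    simp only [map_add, LinearMap.add_apply, add_smul, Finset.sum_add_distrib]
    rw [← hS T (Finset.union_subset_left hT), ← hS' T (Finset.union_subset_right hT)]
  | smul c x hx =>
    obtain ⟨S, hS⟩ := hx
    refine ⟨S, fun T hT => ?_⟩
    simp only [map_smul, LinearMap.smul_apply, smul_assoc, ← Finset.smul_sum]
    rw [← hS T hT]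

end IsPairing

-- The dual family as an integral basis

theorem isDualFamily_iff {β : HPR D →ₗ[ℚ] HPR D →ₗ[ℚ] ℚ} {e : PForest D → HPR D} :
    IsDualFamily β e ↔ ∀ F, IsDualTo β F (e (FreeMonoid.ofList F)) := by
  refine forall_congr' fun F => forall_congr' fun G => ?_
  change β (e F) (monomial G.toList) = _ ↔
    (F = G → β (e F) (monomial G.toList) = 1) ∧ (F ≠ G → β (e F) (monomial G.toList) = 0)
  by_cases h : F = G <;> simp [h]

/-- For uniqueness, a difference of two candidates is orthogonal to all forests, so its expansion in
the dual family is zero. -/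
theorem IsPairing.existsUnique_dualFamily {β : HPR D →ₗ[ℚ] HPR D →ₗ[ℚ] ℚ} (hβ : IsPairing β) :
    ∃! e : PForest D → HPR D, IsDualFamily β e := by
  choose e he hd using hβ.exists_dual
  refine ⟨fun F => e F.toList, isDualFamily_iff.2 hd, fun e' he' => funext fun F => ?_⟩
  have h0 : ∀ G, β (e' F - e F.toList) (monomial G) = 0 := by
    intro G
    have h' := isDualFamily_iff.1 he' F.toList G
    have h := hd F.toList G
    rw [map_sub, LinearMap.sub_apply, sub_eq_zero]
    by_cases hF : F.toList = G
    · rw [h.1 hF]; exact h'.1 hF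
    · rw [h.2 hF]; exact h'.2 hF
  obtain ⟨S, hS⟩ := hβ.exists_eq_sum he hd (e' F - e F.toList)
  have := hS S subset_rfl
  simp only [h0, zero_smul, Finset.sum_const_zero] at this
  exact sub_eq_zero.1 this

/-- Pairing a relation with each forest isolates its coefficients; the family spans because elements
of `APR D` have integral pairings with the forests, and these are their coordinates. -/
theorem IsPairing.exists_basis {β : HPR D →ₗ[ℚ] HPR D →ₗ[ℚ] ℚ} (hβ : IsPairing β)
    {e : PForest D → HPR D} (he : IsDualFamily β e) :
    ∃ b : Module.Basis (PForest D) ℤ (APR D), ∀ F : PForest D, (b F : HPR D) = e F := by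
  classical
  choose e' hm hd using hβ.exists_dual
  obtain rfl : e = fun F => e' F.toList :=
    hβ.existsUnique_dualFamily.unique he (isDualFamily_iff.2 hd)
  have hA : ∀ F : PForest D, e' F.toList ∈ APR D := fun F => mem_APR_of_mem_homogeneous (hm _)
  let v : PForest D → APR D := fun F => ⟨e' F.toList, hA F⟩
  have hli : LinearIndependent ℤ v := by
    refine linearIndependent_iff'.2 fun s g hg F hF => ?_
    have h := congrArg (fun a : APR D => β a (forest F)) hg
    have h' : ∑ G ∈ s, g G • β (e' G.toList) (forest F) = 0 := by
      simpa [v, -zsmul_eq_mul, map_zsmul] using h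
    simp only [zsmul_eq_mul, he _ _, mul_ite, mul_one, mul_zero, Finset.sum_ite_eq', hF, if_true] at h'
    exact_mod_cast h'
  have hsp : ⊤ ≤ Submodule.span ℤ (Set.range v) := by
    rintro ⟨a, ha⟩ -
    obtain ⟨S, hS⟩ := hβ.exists_eq_sum hm hd a
    choose n hn using hβ.exists_apply_eq_intCast ha
    have : (⟨a, ha⟩ : APR D) = ∑ F ∈ S, n F • v (FreeMonoid.ofList F) := by
      apply Subtype.ext
      have := hS S subset_rfl
      simp only [hn] at this
      simpa [v, -zsmul_eq_mul, Int.cast_smul_eq_zsmul] using this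
    rw [this]
    exact sum_mem fun F _ => Submodule.smul_mem _ _ (Submodule.subset_span ⟨_, rfl⟩)
  exact ⟨Module.Basis.mk hli hsp, fun F => by rw [Module.Basis.mk_apply]⟩

end HPR

end

theorem mainTheorem5 (D : Type*) :
    (∀ x ∈ APR D, (∃ n : ℤ, HPR.counit x = n) ∧
      HPR.coproduct x ∈ AddSubgroup.closure
        {z | ∃ a ∈ APR D, ∃ b ∈ APR D, z = a ⊗ₜ[ℚ] b}) ∧
    (∃! β : HPR D →ₗ[ℚ] HPR D →ₗ[ℚ] ℚ, HPR.IsPairing β) ∧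
    ∀ β : HPR D →ₗ[ℚ] HPR D →ₗ[ℚ] ℚ, HPR.IsPairing β →
      (∃! e : PForest D → HPR D, HPR.IsDualFamily β e) ∧
      ∀ e : PForest D → HPR D, HPR.IsDualFamily β e →
        ∃ b : Module.Basis (PForest D) ℤ (APR D), ∀ F : PForest D, (b F : HPR D) = e F :=
  ⟨fun _ hx => ⟨HPR.exists_counit_eq_intCast hx, HPR.coproduct_mem_closure hx⟩,
    ⟨HPR.pairing, HPR.isPairing_pairing, fun _ hβ => hβ.eq_pairing⟩,
    fun _ hβ => ⟨hβ.existsUnique_dualFamily, fun _ he => hβ.exists_basis he⟩⟩
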